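/- For real $\alpha\ge 0$ let $T_\alpha\colon L^2[0,1]\to L^2[0,1]$ be the bounded operator \[ (T_\alpha f)(x)=\int_0^{x^\alpha} f(y)\,dy , \] (so that $T_0f$ is the constant $\int_0^1 f$), and let $\|\cdot\|_{2,2}$ denote the operator norm. For $\alpha>0$ let \[ H_\alpha(z)=\sum_{k=0}^\infty \frac{(-z)^k}{k!\prod_{j=1}^k\bigl(j-\frac1{1+\alpha}\bigr)}, \qquad H_\infty(z)=\sum_{k=0}^\infty\frac{(-z)^k}{(k!)^2}. \] Then $H_\alpha$ (for every $\alpha>0$) and $H_\infty$ have a smallest positive zero, denoted by $h_0(\alpha)$ and $h_0(\infty)$ respectively; $h_0(\infty)=1.445796\ldots$; and \[ \|T_\alpha\|_{2,2}=\frac1{1+\alpha}\sqrt{\frac{\alpha}{h_0(\alpha)}}\qquad\text{for every }\alpha>0. \] Moreover \[ \|T_\alpha\|_{2,2}\sim\frac{1/\sqrt{h_0(\infty)}}{\sqrt\alpha}\quad(\alpha\to\infty),\qquad \|T_\alpha-T_0\|_{2,2}\sim\sqrt{\alpha/h_0(\infty)}\quad(\alpha\to0^+), \] \[ \|T_\alpha\|_{2,2}=1-\tfrac34\alpha+O(\alpha^2)\quad(\alpha\to0^+).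 \] -/

import Mathlib

open MeasureTheory Set Filter Topology Asymptotics

noncomputable section

namespace VolterraType

/-- Lebesgue measure on the interval `[0,1]`, as a measure on `ℝ`. -/
abbrev mu01 : Measure ℝ := volume.restrict (Icc (0 : ℝ) 1)

instance isProbabilityMeasure_mu01 : IsProbabilityMeasure mu01 :=
  ⟨by simp [mu01]⟩

/-- The Banach space `L²[0,1]` of `𝕜`-valued functions. -/
abbrev L2 (𝕜 : Type*) [RCLike 𝕜] := Lp 𝕜 2 mu01

variable {𝕜 : Type*} [RCLike 𝕜]

/-- `x ↦ ∫_0^{x^α} f(y) dy`. The integral is taken for Lebesgue measure on `[0,1]`, which changes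
nothing when `0 ≤ α` and `0 ≤ x ≤ 1`, since then `x^α` lies in `[0,1]` (see `TFun_eq`). -/
def TFun (α : ℝ) (f : ℝ → 𝕜) (x : ℝ) : 𝕜 := ∫ y in (0 : ℝ)..(x ^ α), f y ∂mu01

theorem TFun_eq {α : ℝ} (hα : 0 ≤ α) (f : ℝ → 𝕜) {x : ℝ} (hx : x ∈ Icc (0 : ℝ) 1) :
    TFun α f x = ∫ y in (0 : ℝ)..(x ^ α), f y := by
  have h0 : 0 ≤ x ^ α := Real.rpow_nonneg hx.1 α
  have h1 : x ^ α ≤ 1 := Real.rpow_le_one hx.1 hx.2 hα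
  unfold TFun
  rw [intervalIntegral.integral_of_le h0, intervalIntegral.integral_of_le h0, mu01,
    Measure.restrict_restrict measurableSet_Ioc, inter_eq_left.2]
  exact fun y hy => ⟨hy.1.le, hy.2.trans h1⟩

theorem integrable_L2 (f : L2 𝕜) : Integrable f mu01 :=
  (Lp.memLp f).integrable (by norm_num)

theorem integral_norm_le (f : L2 𝕜) : ∫ y, ‖f y‖ ∂mu01 ≤ ‖f‖ := by
  rw [integral_norm_eq_lintegral_enorm (Lp.aestronglyMeasurable f), Lp.norm_def,
    ← eLpNorm_one_eq_lintegral_enorm]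
  exact ENNReal.toReal_mono (Lp.eLpNorm_ne_top f)
    (eLpNorm_le_eLpNorm_of_exponent_le (by norm_num) (Lp.aestronglyMeasurable f))

theorem norm_TFun_le (α : ℝ) (f : L2 𝕜) (x : ℝ) : ‖TFun α f x‖ ≤ ‖f‖ := by
  refine (intervalIntegral.norm_integral_le_integral_norm_uIoc).trans ?_
  exact (setIntegral_le_integral (integrable_L2 f).norm
    (Eventually.of_forall fun _ => norm_nonneg _)).trans (integral_norm_le f)

theorem memLp_TFun (α : ℝ) (f : L2 𝕜) : MemLp (TFun α f) 2 mu01 := by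
  refine MemLp.of_bound ?_ ‖f‖ (Eventually.of_forall (norm_TFun_le α f))
  have hc : Continuous fun b : ℝ => ∫ y in (0 : ℝ)..b, f y ∂mu01 :=
    intervalIntegral.continuous_primitive (fun a b => (integrable_L2 f).intervalIntegrable) 0
  have hm : Measurable fun x : ℝ => x ^ α := measurable_id.pow_const α
  exact (hc.stronglyMeasurable.comp_measurable hm).aestronglyMeasurable

/-- The operator `T_α : L²[0,1] → L²[0,1]`, `(T_α f)(x) = ∫_0^{x^α} f(y) dy`, for `α ≥ 0`
(so that `T_0 f` is the constant `∫_0^1 f`), as a bounded linear operator. -/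
def T (𝕜 : Type*) [RCLike 𝕜] (α : ℝ) : L2 𝕜 →L[𝕜] L2 𝕜 :=
  LinearMap.mkContinuous
    { toFun := fun f => (memLp_TFun α f).toLp (TFun α f)
      map_add' := fun f g => by
        rw [← MemLp.toLp_add, MemLp.toLp_eq_toLp_iff]
        refine Eventually.of_forall fun x => ?_
        simp only [Pi.add_apply, TFun]
        rw [← intervalIntegral.integral_add (integrable_L2 f).intervalIntegrable
          (integrable_L2 g).intervalIntegrable]
        exact intervalIntegral.integral_congr_ae
          ((Lp.coeFn_add f g).mono fun y hy _ => hy)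
      map_smul' := fun c f => by
        rw [RingHom.id_apply, ← MemLp.toLp_const_smul, MemLp.toLp_eq_toLp_iff]
        refine Eventually.of_forall fun x => ?_
        simp only [Pi.smul_apply, TFun]
        rw [← intervalIntegral.integral_smul]
        exact intervalIntegral.integral_congr_ae
          ((Lp.coeFn_smul c f).mono fun y hy _ => hy) }
    1 (fun f => by
      refine (Lp.norm_le_of_ae_bound (norm_nonneg f) ?_).trans (le_of_eq ?_)
      · exact (MemLp.coeFn_toLp (memLp_TFun α f)).mono fun x hx => by
          simpa [hx] using norm_TFun_le α f x
      · have h1 : measureUnivNNReal mu01 = 1 := by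
          rw [← ENNReal.coe_inj, coe_measureUnivNNReal, measure_univ, ENNReal.coe_one]
        simp [h1])

/-- The defining formula of `T_α`, with the ordinary Lebesgue integral over `[0, x^α]`. -/
theorem T_apply_ae {α : ℝ} (hα : 0 ≤ α) (f : L2 𝕜) :
    ∀ᵐ x ∂mu01, T 𝕜 α f x = ∫ y in (0 : ℝ)..(x ^ α), f y := by
  filter_upwards [MemLp.coeFn_toLp (memLp_TFun α f), ae_restrict_mem measurableSet_Icc]
    with x hx hx01
  exact hx.trans (TFun_eq hα f hx01)

/-- `H_α(z) = ∑_k (-z)^k / (k! ∏_{j=1}^k (j - 1/(1+α)))` for real `z`. -/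
def H (α z : ℝ) : ℝ :=
  ∑' k : ℕ, (-z) ^ k / ((k.factorial : ℝ) * ∏ j ∈ Finset.Icc 1 k, ((j : ℝ) - 1 / (1 + α)))

/-- The series defining `H_α(z)` converges for every `z`. -/
theorem summable_H {α : ℝ} (hα : 0 < α) (z : ℝ) : Summable fun k : ℕ =>
    (-z) ^ k / ((k.factorial : ℝ) * ∏ j ∈ Finset.Icc 1 k, ((j : ℝ) - 1 / (1 + α))) := by
  have hc : 0 < 1 - 1 / (1 + α) := by
    rw [sub_pos, div_lt_one (by linarith)]
    linarith
  refine Summable.of_norm_bounded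
    (Real.summable_pow_div_factorial (|z| / (1 - 1 / (1 + α)))) fun k => ?_
  have hp : (1 - 1 / (1 + α)) ^ k ≤ ∏ j ∈ Finset.Icc 1 k, ((j : ℝ) - 1 / (1 + α)) := by
    calc (1 - 1 / (1 + α)) ^ k = ∏ j ∈ Finset.Icc 1 k, (1 - 1 / (1 + α)) := by simp
      _ ≤ _ := Finset.prod_le_prod (fun _ _ => hc.le) fun j hj => by
        have : (1 : ℝ) ≤ j := by exact_mod_cast (Finset.mem_Icc.1 hj).1
        linarith
  have hp0 := (pow_pos hc k).trans_le hp
  have hk : (0 : ℝ) < k.factorial := by exact_mod_cast k.factorial_pos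
  rw [norm_div, norm_pow, norm_neg, Real.norm_eq_abs, Real.norm_eq_abs,
    abs_of_pos (mul_pos hk hp0), div_pow, div_div, mul_comm]
  gcongr

/-- `H_∞(z) = ∑_k (-z)^k / (k!)^2` for real `z`. -/
def HInf (z : ℝ) : ℝ := ∑' k : ℕ, (-z) ^ k / (k.factorial : ℝ) ^ 2

/-- The set of positive zeros of a real function. -/
def posZeros (F : ℝ → ℝ) : Set ℝ := {z : ℝ | 0 < z ∧ F z = 0}

/-- `h_0(α)`, the smallest positive zero of `H_α`. -/
def h0 (α : ℝ) : ℝ := sInf (posZeros (H α))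

/-- `h_0(∞)`, the smallest positive zero of `H_∞`. -/
def h0Inf : ℝ := sInf (posZeros HInf)

end VolterraType

end

/-!
With `c = 1 - 1/(1+α)`, the function `H_α` is `F c z = ∑ (-z)^k / (k! (c)_k) = ₀F₁(; c; -z)`, and
`H_∞ = F 1`.

*The norm.* Differentiating `T_α^* T_α φ = μ φ` twice gives a Bessel-type equation with boundary
conditions at `0` and `1`, solved by `φ(y) = F c (h y^{1/c})` whenever `F c h = 0`, with
`μ = α / ((1+α)² h)`. For the smallest positive zero `h = h₀(α)` the function `φ` is positive on
`[0,1)`. As `T_α` has a nonnegative kernel, a positive eigenfunction of `T_α^* T_α` determines the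
norm (Schur's test): Cauchy-Schwarz with weight `φ` gives
`|T_α f(x)|² ≤ Φ(x^α) ∫_0^{x^α} |f|² / φ`, where `Φ` is the primitive of `φ`, and Tonelli's theorem
turns the integral of the right-hand side into `μ ‖f‖²`, since `∫_{y^{1/α}}^1 Φ(x^α) dx = μ φ(y)`.
The same identity with `f = φ` gives equality. Hence `‖T_α‖² = μ`; no spectral theory of compact
operators is needed. The lemmas are `lintegral_eigenPrim_mul_lintegral`, `norm_T_sq_le` and
`norm_T_eigenvec_sq`. The only facts needed on `F` are `F_c' = -F_{c+1} / c` and a contiguous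
relation, both read off the coefficients.

*The first zero.* For `0 ≤ z ≤ 1 + c` the terms of `F c z` decrease in absolute value from the
second one on, so `F c z` lies between consecutive partial sums. For `0 < c ≤ 1` it follows that
`F c` is strictly decreasing on `[0, 1 + c]` and negative at `1 + c`, so `z < h₀` is decided by the
sign of `F c z` at one trial point `z` (`F_pos_iff`, `F_neg_iff`). Trial points give the decimals of
`h₀(∞)`, the continuity of the first zero as `c → 1`, and its expansion `c (1 + c/2 + O(c²))` as
`c → 0`.

*The asymptotics.* The limits `α → ∞` and `α → 0` of `‖T_α‖` correspond to `c → 1` and `c → 0`.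
Finally `T_0 - T_α` is the adjoint of `T_{1/α}`, which reduces `‖T_α - T_0‖` as `α → 0` to
`‖T_α‖` as `α → ∞`.
-/

noncomputable section

namespace VolterraType

/-! ### The power series `F c` -/

/-- The coefficient `1 / (k! (c)_k)`, where `(c)_k = c (c + 1) ⋯ (c + k - 1)`. -/
def coef (c : ℝ) (k : ℕ) : ℝ := 1 / ((k.factorial : ℝ) * ∏ j ∈ Finset.range k, (c + j))

/-- The confluent hypergeometric limit function `₀F₁(; c; -z) = ∑ (-z)^k / (k! (c)_k)`. -/
def F (c z : ℝ) : ℝ := ∑' k : ℕ, coef c k * (-z) ^ k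

theorem coef_pos {c : ℝ} (hc : 0 < c) (k : ℕ) : 0 < coef c k := by
  unfold coef
  have : 0 < ∏ j ∈ Finset.range k, (c + (j : ℝ)) := Finset.prod_pos fun j _ => by positivity
  positivity

theorem coef_zero (c : ℝ) : coef c 0 = 1 := by simp [coef]

theorem coef_eq_mul_coef_succ {c : ℝ} (hc : 0 < c) (k : ℕ) :
    coef c k = (k + 1) * (c + k) * coef c (k + 1) := by
  have : 0 < ∏ j ∈ Finset.range k, (c + (j : ℝ)) := Finset.prod_pos fun j _ => by positivity
  have h1 : (0 : ℝ) < k.factorial := by positivity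
  have h2 : 0 < c + k := by positivity
  unfold coef
  rw [Finset.prod_range_succ, Nat.factorial_succ]
  push_cast
  field_simp

theorem coef_succ_param {c : ℝ} (hc : 0 < c) (k : ℕ) :
    coef (c + 1) k = c * (k + 1) * coef c (k + 1) := by
  have : 0 < ∏ j ∈ Finset.range k, (c + 1 + (j : ℝ)) := Finset.prod_pos fun j _ => by positivity
  have h1 : (0 : ℝ) < k.factorial := by positivity
  unfold coef
  rw [Finset.prod_range_succ', Nat.factorial_succ]
  have h3 : ∏ j ∈ Finset.range k, (c + ((j + 1 : ℕ) : ℝ))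
      = ∏ j ∈ Finset.range k, (c + 1 + (j : ℝ)) :=
    Finset.prod_congr rfl fun j _ => by push_cast; ring
  rw [h3]
  push_cast
  field_simp
  simp

theorem coef_le {b c : ℝ} (hb : 0 < b) (hbc : b ≤ c) (k : ℕ) :
    coef c k ≤ (1 / b) ^ k / k.factorial := by
  have hp : b ^ k ≤ ∏ j ∈ Finset.range k, (c + (j : ℝ)) := by
    calc b ^ k = ∏ j ∈ Finset.range k, b := by simp
      _ ≤ _ := Finset.prod_le_prod (fun _ _ => hb.le) fun j _ => by
        have : (0 : ℝ) ≤ j := j.cast_nonneg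
        linarith
  have h1 : (0 : ℝ) < k.factorial := by positivity
  unfold coef
  rw [one_div_pow, div_div, mul_comm (b ^ k)]
  gcongr

theorem summable_coef_mul_pow {c : ℝ} (hc : 0 < c) (z : ℝ) :
    Summable fun k => coef c k * z ^ k := by
  refine Summable.of_norm_bounded (Real.summable_pow_div_factorial (|z| / c)) fun k => ?_
  rw [norm_mul, norm_pow, Real.norm_eq_abs, Real.norm_eq_abs, abs_of_pos (coef_pos hc k)]
  calc coef c k * |z| ^ k ≤ (1 / c) ^ k / k.factorial * |z| ^ k := by
        gcongr; exact coef_le hc le_rfl k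
    _ = _ := by rw [div_pow, div_pow]; ring

theorem hasSum_F {c : ℝ} (hc : 0 < c) (z : ℝ) : HasSum (fun k => coef c k * (-z) ^ k) (F c z) :=
  (summable_coef_mul_pow hc (-z)).hasSum

theorem F_zero (c : ℝ) : F c 0 = 1 := by
  unfold F
  rw [tsum_eq_single 0]
  · simp [coef_zero]
  · intro k hk; simp [hk]

theorem hasDerivAt_F {c : ℝ} (hc : 0 < c) (z : ℝ) :
    HasDerivAt (F c) (-(1 / c) * F (c + 1) z) z := by
  have hkey : ∀ (k : ℕ) (w : ℝ),
      coef c (k + 1) * ((k + 1 : ℕ) * w ^ k) = 1 / c * (coef (c + 1) k * w ^ k) := by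
    intro k w
    rw [coef_succ_param hc]
    push_cast
    field_simp
  obtain ⟨R, hzR'⟩ : ∃ R, |z| < R := exists_gt _
  have hR : 0 < R := (abs_nonneg z).trans_lt hzR'
  have hzR : z ∈ Metric.ball (0 : ℝ) R := by simpa using hzR'
  have hu : Summable fun k : ℕ => coef c k * (k * R ^ (k - 1)) := by
    rw [← summable_nat_add_iff 1]
    simp only [Nat.add_sub_cancel, hkey]
    exact (summable_coef_mul_pow (by linarith) R).mul_left _
  have hd : HasDerivAt (F c) (∑' k : ℕ, coef c k * (k * (-z) ^ (k - 1) * (-1))) z := by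
    have h0 : Summable fun k : ℕ => coef c k * (-(0 : ℝ)) ^ k := summable_coef_mul_pow hc (-0)
    refine hasDerivAt_tsum_of_isPreconnected (g := fun k w => coef c k * (-w) ^ k)
      (g' := fun k w => coef c k * (k * (-w) ^ (k - 1) * (-1))) hu
      (t := Metric.ball 0 R) Metric.isOpen_ball
      (convex_ball _ _).isPreconnected (fun k y _ => ?_) (fun k y hy => ?_)
      (y₀ := 0) (Metric.mem_ball_self hR) h0 hzR
    · have := ((hasDerivAt_neg y).fun_pow k).const_mul (coef c k)
      exact this
    · have : |y| ≤ R := by simpa using (mem_ball_zero_iff.1 hy).le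
      rw [norm_mul, norm_mul, norm_mul, norm_pow]
      simp only [Real.norm_eq_abs, abs_neg, abs_one, mul_one, Nat.abs_cast,
        abs_of_pos (coef_pos hc k)]
      have := (coef_pos hc k).le
      gcongr
  convert hd using 1
  have hs : Summable fun k : ℕ => coef c k * (k * (-z) ^ (k - 1) * (-1)) := by
    refine Summable.of_norm_bounded hu fun k => ?_
    rw [norm_mul, norm_mul, norm_mul, norm_pow]
    simp only [Real.norm_eq_abs, abs_neg, abs_one, mul_one, Nat.abs_cast,
      abs_of_pos (coef_pos hc k)]
    have := (coef_pos hc k).le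
    gcongr
  rw [hs.tsum_eq_zero_add]
  simp only [Nat.cast_zero, zero_mul, mul_zero, zero_add, Nat.add_sub_cancel]
  rw [F, ← tsum_mul_left]
  refine tsum_congr fun k => ?_
  linear_combination hkey k (-z)

theorem continuous_F {c : ℝ} (hc : 0 < c) : Continuous (F c) :=
  continuous_iff_continuousAt.2 fun z => (hasDerivAt_F hc z).continuousAt

/-- The contiguous relation `F_{c+1} + (z/c) F_{c+1}' = F_c`, with `F_{c+1}' = -F_{c+2} / (c+1)`. -/
theorem F_contiguous {c : ℝ} (hc : 0 < c) (z : ℝ) :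
    F (c + 1) z + z / c * (-(1 / (c + 1)) * F (c + 1 + 1) z) = F c z := by
  have hc1 : 0 < c + 1 := by linarith
  have h1 := (hasSum_F hc1 z)
  have h2 := ((hasSum_F (c := c + 1 + 1) (by linarith) z).mul_left
    (z / c * (-(1 / (c + 1)))))
  have h3 := hasSum_F hc z
  rw [← hasSum_nat_add_iff' 1] at h1 h3
  have h4 := (h1.add h2).unique (h3.congr_fun ?_)
  · simp only [Finset.sum_range_one, coef_zero, pow_zero] at h4
    linarith
  · intro k
    rw [coef_succ_param hc1 k, coef_succ_param hc (k + 1), coef_eq_mul_coef_succ hc (k+1)]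
    push_cast
    field_simp
    ring

/-! ### Alternating bounds and the first zero -/

/-- For `0 ≤ z ≤ 1 + c` the terms of the series for `F c z` decrease in absolute value from the
second one on. -/
theorem antitone_terms {c z : ℝ} (hc : 0 < c) (hz : 0 ≤ z) (hz1 : z ≤ 1 + c) :
    Antitone fun k => coef c (k + 1) * z ^ (k + 1) := by
  refine antitone_nat_of_succ_le fun k => ?_
  rw [coef_eq_mul_coef_succ hc (k + 1), pow_succ z (k + 1)]
  have h1 := (coef_pos hc (k + 1 + 1)).le
  have h2 : z ≤ ((k + 1 : ℕ) + 1) * (c + (k + 1 : ℕ)) := by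
    have : (0 : ℝ) ≤ k := k.cast_nonneg
    push_cast
    nlinarith [mul_nonneg this hc.le]
  have h3 := pow_nonneg hz (k + 1)
  nlinarith [mul_le_mul_of_nonneg_left h2 (mul_nonneg h1 h3)]

theorem tendsto_one_sub_F {c : ℝ} (hc : 0 < c) (z : ℝ) :
    Tendsto (fun n => ∑ k ∈ Finset.range n, (-1) ^ k * (coef c (k + 1) * z ^ (k + 1))) atTop
      (𝓝 (1 - F c z)) := by
  have h := hasSum_F hc z
  rw [← hasSum_nat_add_iff' 1] at h
  simp only [Finset.sum_range_one, coef_zero, pow_zero, mul_one] at h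
  have h' := h.neg.tendsto_sum_nat
  rw [neg_sub] at h'
  refine h'.congr fun n => Finset.sum_congr rfl fun k _ => ?_
  rw [neg_pow z]
  ring

theorem F_le_partial_sum {c z : ℝ} (hc : 0 < c) (hz : 0 ≤ z) (hz1 : z ≤ 1 + c) (n : ℕ) :
    F c z ≤ 1 - ∑ k ∈ Finset.range (2 * n), (-1) ^ k * (coef c (k + 1) * z ^ (k + 1)) := by
  have := (antitone_terms hc hz hz1).alternating_series_le_tendsto (tendsto_one_sub_F hc z) n
  linarith

theorem partial_sum_le_F {c z : ℝ} (hc : 0 < c) (hz : 0 ≤ z) (hz1 : z ≤ 1 + c) (n : ℕ) :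
    1 - ∑ k ∈ Finset.range (2 * n + 1), (-1) ^ k * (coef c (k + 1) * z ^ (k + 1)) ≤ F c z := by
  have := (antitone_terms hc hz hz1).tendsto_le_alternating_series (tendsto_one_sub_F hc z) n
  linarith

/-- Up to sign and scaling, `F (c + 1)` is the derivative of `F c`. -/
theorem F_succ_pos {c z : ℝ} (hc : 0 < c) (hz : 0 ≤ z) (hz1 : z < 1 + c) : 0 < F (c + 1) z := by
  have h := partial_sum_le_F (c := c + 1) (by linarith) hz (by linarith) 0
  have h1 : coef (c + 1) 1 = 1 / (c + 1) := by simp [coef]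
  simp only [mul_zero, zero_add, Finset.sum_range_one, pow_zero, one_mul, pow_one, h1] at h
  have : 1 / (c + 1) * z < 1 := by
    rw [one_div_mul_eq_div, div_lt_one (by linarith)]; linarith
  linarith

theorem strictAntiOn_F {c : ℝ} (hc : 0 < c) : StrictAntiOn (F c) (Icc 0 (1 + c)) := by
  refine strictAntiOn_of_deriv_neg (convex_Icc _ _) (continuous_F hc).continuousOn fun z hz => ?_
  rw [interior_Icc] at hz
  rw [(hasDerivAt_F hc z).deriv]
  have : 0 < 1 / c := by positivity
  nlinarith [mul_pos this (F_succ_pos hc hz.1.le hz.2)]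

theorem F_one_add_self_neg {c : ℝ} (hc : 0 < c) (hc1 : c ≤ 1) : F c (1 + c) < 0 := by
  have h := F_le_partial_sum hc (z := 1 + c) (by linarith) le_rfl 2
  have e1 : coef c 1 = 1 / c := by simp [coef]
  have e2 : coef c 2 = 1 / (2 * (c * (1 + c))) := by
    simp [coef, Finset.prod_range_succ, Nat.factorial, add_comm]
  have e3 := coef_eq_mul_coef_succ hc 3
  have e4 := coef_pos hc 4
  have h3 : 0 < (1 + c) ^ 3 := by positivity
  simp only [Finset.sum_range_succ, Finset.sum_range_zero, Nat.reduceMul, Nat.reduceAdd, e1,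
    e2, e3] at h
  -- The second and third terms already cancel the constant term; the next two are strictly negative.
  have h12 : 1 ≤ 1 / c * (1 + c) - 1 / (2 * (c * (1 + c))) * (1 + c) ^ 2 := by
    have : 1 / c * (1 + c) - 1 / (2 * (c * (1 + c))) * (1 + c) ^ 2 = (1 + c) / (2 * c) := by
      field_simp; ring
    rw [this, le_div_iff₀ (by positivity)]; linarith
  push_cast at h
  have h34 : 0 < coef c 4 * (1 + c) ^ 3 * ((3 + 1) * (c + 3) - (1 + c)) := by
    have : 0 < (3 + 1) * (c + 3) - (1 + c) := by linarith
    positivity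
  nlinarith

/-- The smallest positive zero of `F c` (a genuine minimum for `0 < c ≤ 1`, see
`isLeast_firstZero`). -/
def firstZero (c : ℝ) : ℝ := sInf (posZeros (F c))

theorem isLeast_firstZero_and_lt {c : ℝ} (hc : 0 < c) (hc1 : c ≤ 1) :
    IsLeast (posZeros (F c)) (firstZero c) ∧ firstZero c < 1 + c := by
  have hneg := F_one_add_self_neg hc hc1
  obtain ⟨z, hz, hz0⟩ : (0 : ℝ) ∈ F c '' Ioo 0 (1 + c) :=
    intermediate_value_Ioo' (by linarith) (continuous_F hc).continuousOn
      ⟨hneg, by rw [F_zero]; norm_num⟩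
  have hl : IsLeast (posZeros (F c)) z := by
    refine ⟨⟨hz.1, hz0⟩, fun w hw => ?_⟩
    by_contra! hlt
    have := strictAntiOn_F hc ⟨hw.1.le, by linarith [hz.2]⟩ ⟨hz.1.le, hz.2.le⟩ hlt
    rw [hz0, hw.2] at this
    exact lt_irrefl _ this
  have e : firstZero c = z := hl.csInf_eq
  rw [e]
  exact ⟨hl, hz.2⟩

theorem isLeast_firstZero {c : ℝ} (hc : 0 < c) (hc1 : c ≤ 1) :
    IsLeast (posZeros (F c)) (firstZero c) := (isLeast_firstZero_and_lt hc hc1).1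

theorem firstZero_lt {c : ℝ} (hc : 0 < c) (hc1 : c ≤ 1) : firstZero c < 1 + c :=
  (isLeast_firstZero_and_lt hc hc1).2

theorem firstZero_pos {c : ℝ} (hc : 0 < c) (hc1 : c ≤ 1) : 0 < firstZero c :=
  (isLeast_firstZero hc hc1).1.1

theorem F_firstZero {c : ℝ} (hc : 0 < c) (hc1 : c ≤ 1) : F c (firstZero c) = 0 :=
  (isLeast_firstZero hc hc1).1.2

/-- On `[0, 1 + c]`, which contains the first zero, `F c` is positive exactly before that zero. -/
theorem F_pos_iff {c z : ℝ} (hc : 0 < c) (hc1 : c ≤ 1) (hz : 0 ≤ z) (hz1 : z ≤ 1 + c) :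
    0 < F c z ↔ z < firstZero c := by
  rw [← F_firstZero hc hc1]
  exact (strictAntiOn_F hc).lt_iff_gt
    ⟨(firstZero_pos hc hc1).le, (firstZero_lt hc hc1).le⟩ ⟨hz, hz1⟩

theorem F_neg_iff {c z : ℝ} (hc : 0 < c) (hc1 : c ≤ 1) (hz : 0 ≤ z) (hz1 : z ≤ 1 + c) :
    F c z < 0 ↔ firstZero c < z := by
  rw [← F_firstZero hc hc1]
  exact (strictAntiOn_F hc).lt_iff_gt
    ⟨hz, hz1⟩ ⟨(firstZero_pos hc hc1).le, (firstZero_lt hc hc1).le⟩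

/-! ### The functions `H_α` and `H_∞` -/

theorem H_eq_F (α : ℝ) : H α = F (1 - 1 / (1 + α)) := by
  funext z
  unfold H F coef
  refine tsum_congr fun k => ?_
  rw [one_div_mul_eq_div]
  congr 2
  rw [Finset.range_eq_Ico, ← Finset.prod_Ico_add_right_sub_eq (c := 1)]
  refine Finset.prod_congr (by ext; simp ) fun j hj => ?_
  rw [Nat.cast_sub (Finset.mem_Icc.1 hj).1]
  push_cast
  ring

theorem HInf_eq_F : HInf = F 1 := by
  funext z
  unfold HInf F coef
  refine tsum_congr fun k => ?_
  have : ∏ j ∈ Finset.range k, ((1 : ℝ) + j) = k.factorial := by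
    rw [← Finset.prod_range_add_one_eq_factorial]
    push_cast
    exact Finset.prod_congr rfl fun j _ => add_comm _ _
  rw [one_div_mul_eq_div, this, sq]

theorem h0_eq_firstZero (α : ℝ) : h0 α = firstZero (1 - 1 / (1 + α)) := by
  rw [h0, H_eq_F, firstZero]

theorem h0Inf_eq_firstZero : h0Inf = firstZero 1 := by
  rw [h0Inf, HInf_eq_F, firstZero]

theorem firstZero_one_mem : 1.445796 ≤ firstZero 1 ∧ firstZero 1 < 1.445797 := by
  constructor
  · refine ((F_pos_iff one_pos le_rfl (by norm_num) (by norm_num)).1 ?_).le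
    refine lt_of_lt_of_le ?_ (partial_sum_le_F one_pos (by norm_num) (by norm_num) 3)
    simp only [coef, Finset.sum_range_succ, Finset.prod_range_succ, Finset.sum_range_zero,
      Finset.prod_range_zero, Nat.factorial]
    norm_num
  · refine (F_neg_iff one_pos le_rfl (by norm_num) (by norm_num)).1 ?_
    refine lt_of_le_of_lt (F_le_partial_sum one_pos (by norm_num) (by norm_num) 4) ?_
    simp only [coef, Finset.sum_range_succ, Finset.prod_range_succ, Finset.sum_range_zero,
      Finset.prod_range_zero, Nat.factorial]
    norm_num

/-! ### The positive eigenfunction of `T_α^* T_α` -/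

/-- The eigenfunction `y ↦ F c (h y^{1/c})` of `T_α^* T_α`, where `c = 1 - 1/(1+α)` and `h` is the
first zero of `F c`. -/
def eigenfun (c y : ℝ) : ℝ := F c (firstZero c * y ^ (1 / c))

/-- The primitive of `eigenfun c` that vanishes at `0`, see `integral_eigenfun`. -/
def eigenPrim (c t : ℝ) : ℝ := t * F (c + 1) (firstZero c * t ^ (1 / c))

variable {c : ℝ}

theorem continuous_eigenfun (hc : 0 < c) : Continuous (eigenfun c) :=
  (continuous_F hc).comp (continuous_const.mul
    (Real.continuous_rpow_const (by positivity)))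

theorem continuous_eigenPrim (hc : 0 < c) : Continuous (eigenPrim c) :=
  continuous_id.mul ((continuous_F (by linarith)).comp (continuous_const.mul
    (Real.continuous_rpow_const (by positivity))))

theorem eigenfun_pos (hc : 0 < c) (hc1 : c ≤ 1) {y : ℝ} (hy : y ∈ Ico (0 : ℝ) 1) :
    0 < eigenfun c y := by
  have hp := firstZero_pos hc hc1
  have hl := firstZero_lt hc hc1
  have h1 : y ^ (1 / c) < 1 := Real.rpow_lt_one hy.1 hy.2 (by positivity)
  have h0 : 0 ≤ y ^ (1 / c) := Real.rpow_nonneg hy.1 _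
  have h2 : firstZero c * y ^ (1 / c) < firstZero c := by nlinarith
  exact (F_pos_iff hc hc1 (by positivity) (by linarith)).2 h2

theorem eigenfun_one (hc : 0 < c) (hc1 : c ≤ 1) : eigenfun c 1 = 0 := by
  simp [eigenfun, F_firstZero hc hc1]

theorem eigenfun_nonneg (hc : 0 < c) (hc1 : c ≤ 1) {y : ℝ} (hy : y ∈ Icc (0 : ℝ) 1) :
    0 ≤ eigenfun c y := by
  rcases hy.2.eq_or_lt with rfl | h
  · exact (eigenfun_one hc hc1).ge
  · exact (eigenfun_pos hc hc1 ⟨hy.1, h⟩).le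

theorem hasDerivAt_eigenPrim (hc : 0 < c) {t : ℝ} (ht : 0 < t) :
    HasDerivAt (eigenPrim c) (eigenfun c t) t := by
  have h1 : HasDerivAt (fun t : ℝ => firstZero c * t ^ (1 / c))
      (firstZero c * (1 / c * t ^ (1 / c - 1))) t :=
    (Real.hasDerivAt_rpow_const (Or.inl ht.ne')).const_mul _
  have h2 := (hasDerivAt_id t).mul
    ((hasDerivAt_F (c := c + 1) (by linarith) (firstZero c * t ^ (1 / c))).comp t h1)
  refine h2.congr_deriv ?_
  rw [eigenfun, ← F_contiguous hc]
  have h3 : t ^ (1 / c) = t * t ^ (1 / c - 1) := by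
    rw [Real.rpow_sub_one ht.ne']; field_simp
  simp only [id, Function.comp]
  linear_combination (firstZero c * (1 / c) * (1 / (c + 1)) *
    F (c + 1 + 1) (firstZero c * t ^ (1 / c))) * h3

theorem integral_eigenfun (hc : 0 < c) {t : ℝ} (ht : 0 ≤ t) :
    ∫ y in (0 : ℝ)..t, eigenfun c y = eigenPrim c t := by
  rw [intervalIntegral.integral_eq_sub_of_hasDerivAt_of_le ht
    (continuous_eigenPrim hc).continuousOn (fun y hy => hasDerivAt_eigenPrim hc hy.1)
    ((continuous_eigenfun hc).intervalIntegrable _ _)]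
  simp [eigenPrim]

theorem eigenPrim_nonneg (hc : 0 < c) (hc1 : c ≤ 1) {t : ℝ} (ht : t ∈ Icc (0 : ℝ) 1) :
    0 ≤ eigenPrim c t := by
  rw [← integral_eigenfun hc ht.1]
  exact intervalIntegral.integral_nonneg ht.1 fun y hy =>
    eigenfun_nonneg hc hc1 ⟨hy.1, hy.2.trans ht.2⟩

theorem one_sub_inv_pos {α : ℝ} (hα : 0 < α) : 0 < 1 - 1 / (1 + α) := by
  rw [sub_pos, div_lt_one (by linarith)]; linarith

theorem one_sub_inv_lt {α : ℝ} (hα : 0 < α) : 1 - 1 / (1 + α) < 1 := by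
  have : 0 < 1 / (1 + α) := by positivity
  linarith

/-- The eigenvalue of `T_α^* T_α` that belongs to `eigenfun`; it equals `‖T_α‖²` by `norm_T_sq`. -/
def topEigenvalue (α : ℝ) : ℝ := α / ((1 + α) ^ 2 * h0 α)

theorem h0_pos {α : ℝ} (hα : 0 < α) : 0 < h0 α := by
  rw [h0_eq_firstZero]
  exact firstZero_pos (one_sub_inv_pos hα) (one_sub_inv_lt hα).le

theorem topEigenvalue_pos {α : ℝ} (hα : 0 < α) : 0 < topEigenvalue α := by
  have := h0_pos hα
  unfold topEigenvalue
  positivity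

theorem hasDerivAt_eigenfun_rpow {α : ℝ} (hα : 0 < α) {x : ℝ} (hx : 0 < x) :
    HasDerivAt (fun x => -(topEigenvalue α * eigenfun (1 - 1 / (1 + α)) (x ^ α)))
      (eigenPrim (1 - 1 / (1 + α)) (x ^ α)) x := by
  have hc := one_sub_inv_pos hα
  have hh := h0_pos hα
  have hcc : 1 / (1 - 1 / (1 + α)) = (1 + α) / α := by
    have : 1 - 1 / (1 + α) = α / (1 + α) := by field_simp; ring
    rw [this, one_div_div]
  have hpow : ∀ {w : ℝ}, 0 < w → (w ^ α) ^ (1 / (1 - 1 / (1 + α))) = w ^ (1 + α) := by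
    intro w hw
    rw [hcc, ← Real.rpow_mul hw.le]
    congr 1
    field_simp
  have h1 : HasDerivAt (fun x : ℝ => h0 α * x ^ (1 + α)) (h0 α * ((1 + α) * x ^ (1 + α - 1))) x :=
    (Real.hasDerivAt_rpow_const (Or.inl hx.ne')).const_mul _
  have h2 := (((hasDerivAt_F hc (h0 α * x ^ (1 + α))).comp x h1).const_mul (topEigenvalue α)).neg
  have h3 := h2.congr_of_eventuallyEq
    (f₁ := fun x => -(topEigenvalue α * eigenfun (1 - 1 / (1 + α)) (x ^ α))) (by
      filter_upwards [lt_mem_nhds hx] with w hw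
      simp only [eigenfun, hpow hw, h0_eq_firstZero, Pi.neg_apply, Function.comp])
  refine h3.congr_deriv ?_
  rw [eigenPrim, hpow hx, ← h0_eq_firstZero, hcc, add_sub_cancel_left, topEigenvalue]
  field_simp

/-- The eigenvalue equation for `T_α^* T_α`: its value on `eigenfun` at the point `a^α` is the
integral on the left. -/
theorem integral_eigenPrim_rpow {α : ℝ} (hα : 0 < α) {a : ℝ} (ha : a ∈ Icc (0 : ℝ) 1) :
    ∫ x in a..1, eigenPrim (1 - 1 / (1 + α)) (x ^ α)
      = topEigenvalue α * eigenfun (1 - 1 / (1 + α)) (a ^ α) := by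
  have hc := one_sub_inv_pos hα
  have hr : Continuous fun x : ℝ => x ^ α := Real.continuous_rpow_const hα.le
  rw [intervalIntegral.integral_eq_sub_of_hasDerivAt_of_le ha.2
    (((continuous_eigenfun hc).comp hr).const_mul (topEigenvalue α)).neg.continuousOn
    (fun y hy => hasDerivAt_eigenfun_rpow hα (ha.1.trans_lt hy.1))
    (((continuous_eigenPrim hc).comp hr).intervalIntegrable _ _)]
  simp only [Function.comp, Pi.neg_apply, Real.one_rpow, eigenfun_one hc (one_sub_inv_lt hα).le]
  ring

theorem rpow_mem_Icc {α : ℝ} (hα : 0 ≤ α) {x : ℝ} (hx : x ∈ Icc (0 : ℝ) 1) :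
    x ^ α ∈ Icc (0 : ℝ) 1 :=
  ⟨Real.rpow_nonneg hx.1 α, Real.rpow_le_one hx.1 hx.2 hα⟩

theorem lintegral_eigenfun (hc : 0 < c) (hc1 : c ≤ 1) {t : ℝ} (ht : t ∈ Icc (0 : ℝ) 1) :
    ∫⁻ y in Ioc 0 t, ENNReal.ofReal (eigenfun c y) = ENNReal.ofReal (eigenPrim c t) := by
  rw [← integral_eigenfun hc ht.1, intervalIntegral.integral_of_le ht.1,
    ofReal_integral_eq_lintegral_ofReal
      ((continuous_eigenfun hc).integrableOn_Ioc)]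
  filter_upwards [ae_restrict_mem measurableSet_Ioc] with y hy
  exact eigenfun_nonneg hc hc1 ⟨hy.1.le, hy.2.trans ht.2⟩

theorem lintegral_eigenPrim_rpow {α : ℝ} (hα : 0 < α) {a : ℝ} (ha : a ∈ Icc (0 : ℝ) 1) :
    ∫⁻ x in Ioc a 1, ENNReal.ofReal (eigenPrim (1 - 1 / (1 + α)) (x ^ α))
      = ENNReal.ofReal (topEigenvalue α * eigenfun (1 - 1 / (1 + α)) (a ^ α)) := by
  have hc := one_sub_inv_pos hα
  have hr : Continuous fun x : ℝ => x ^ α := Real.continuous_rpow_const hα.le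
  rw [← integral_eigenPrim_rpow hα ha, intervalIntegral.integral_of_le ha.2,
    ofReal_integral_eq_lintegral_ofReal (f := fun x => eigenPrim (1 - 1 / (1 + α)) (x ^ α))
      (((continuous_eigenPrim hc).comp hr).integrableOn_Ioc)]
  filter_upwards [ae_restrict_mem measurableSet_Ioc] with x hx
  exact eigenPrim_nonneg hc (one_sub_inv_lt hα).le
    (rpow_mem_Icc hα.le ⟨ha.1.trans hx.1.le, hx.2⟩)

theorem le_rpow_iff {α : ℝ} (hα : 0 < α) {x y : ℝ} (hx : 0 ≤ x) (hy : 0 ≤ y) :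
    y ≤ x ^ α ↔ y ^ (1 / α) ≤ x := by
  rw [one_div, Real.rpow_inv_le_iff_of_pos hy hx hα]

/-! ### Schur's test -/

/-- Tonelli's theorem on the region `y ≤ x^α`: weighting the primitive of `g` by the primitive of
the eigenfunction amounts to weighting `g` by the eigenfunction. -/
theorem lintegral_eigenPrim_mul_lintegral {α : ℝ} (hα : 0 < α) {g : ℝ → ENNReal}
    (hg : Measurable g) :
    ∫⁻ x in Ioc 0 1, ENNReal.ofReal (eigenPrim (1 - 1 / (1 + α)) (x ^ α)) *
        ∫⁻ y in Ioc 0 (x ^ α), g y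
      = ENNReal.ofReal (topEigenvalue α) *
        ∫⁻ y in Ioc 0 1, g y * ENNReal.ofReal (eigenfun (1 - 1 / (1 + α)) y) := by
  have hc := one_sub_inv_pos hα
  have hr : Continuous fun x : ℝ => x ^ α := Real.continuous_rpow_const hα.le
  set P : ℝ → ENNReal := fun x => ENNReal.ofReal (eigenPrim (1 - 1 / (1 + α)) (x ^ α)) with hP
  have hPm : Measurable P :=
    ENNReal.measurable_ofReal.comp ((continuous_eigenPrim hc).comp hr).measurable
  set S : Set (ℝ × ℝ) := {p | p.2 ≤ p.1 ^ α} with hS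
  have hSm : MeasurableSet S :=
    measurableSet_le measurable_snd (hr.measurable.comp measurable_fst)
  have hKm : Measurable (S.indicator fun p : ℝ × ℝ => P p.1 * g p.2) :=
    ((hPm.comp measurable_fst).mul (hg.comp measurable_snd)).indicator hSm
  calc ∫⁻ x in Ioc 0 1, P x * ∫⁻ y in Ioc 0 (x ^ α), g y
      = ∫⁻ x in Ioc 0 1, ∫⁻ y in Ioc 0 1, S.indicator (fun p : ℝ × ℝ => P p.1 * g p.2) (x, y) := by
        refine setLIntegral_congr_fun measurableSet_Ioc fun x hx => ?_
        have hx' := rpow_mem_Icc hα.le ⟨hx.1.le, hx.2⟩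
        rw [← lintegral_const_mul _ hg]
        have e : (fun y => S.indicator (fun p : ℝ × ℝ => P p.1 * g p.2) (x, y))
            = (Iic (x ^ α)).indicator fun y => P x * g y := by
          funext y; simp [indicator, hS]
        rw [e, lintegral_indicator measurableSet_Iic, Measure.restrict_restrict measurableSet_Iic]
        congr 2
        ext y
        simp only [mem_Ioc, mem_inter_iff, mem_Iic]
        exact ⟨fun h => ⟨h.2, h.1, h.2.trans hx'.2⟩, fun h => ⟨h.2.1, h.1⟩⟩
    _ = ∫⁻ y in Ioc 0 1, ∫⁻ x in Ioc 0 1, S.indicator (fun p : ℝ × ℝ => P p.1 * g p.2) (x, y) :=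
        lintegral_lintegral_swap hKm.aemeasurable
    _ = ∫⁻ y in Ioc 0 1, ENNReal.ofReal (topEigenvalue α) *
          (g y * ENNReal.ofReal (eigenfun (1 - 1 / (1 + α)) y)) := by
        refine setLIntegral_congr_fun measurableSet_Ioc fun y hy => ?_
        have hy' : y ^ (1 / α) ∈ Icc (0 : ℝ) 1 :=
          rpow_mem_Icc (by positivity) ⟨hy.1.le, hy.2⟩
        have hy0 : 0 < y ^ (1 / α) := Real.rpow_pos_of_pos hy.1 _
        have e : EqOn (fun x => S.indicator (fun p : ℝ × ℝ => P p.1 * g p.2) (x, y))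
            ((Ici (y ^ (1 / α))).indicator fun x => g y * P x) (Ioc 0 1) := by
          intro x hx
          simp only [indicator, hS, mem_ofPred_eq, mem_Ici, le_rpow_iff hα hx.1.le hy.1.le,
            mul_comm]
        rw [setLIntegral_congr_fun measurableSet_Ioc e, lintegral_indicator measurableSet_Ici,
          Measure.restrict_restrict measurableSet_Ici]
        have e2 : Ici (y ^ (1 / α)) ∩ Ioc 0 1 = Icc (y ^ (1 / α)) 1 := by
          ext x
          simp only [mem_Ioc, mem_inter_iff, mem_Ici, mem_Icc]
          exact ⟨fun h => ⟨h.1, h.2.2⟩, fun h => ⟨h.1, hy0.trans_le h.1, h.2⟩⟩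
        rw [e2, ← Measure.restrict_congr_set Ioc_ae_eq_Icc, lintegral_const_mul _ hPm,
          lintegral_eigenPrim_rpow hα hy', ← Real.rpow_mul hy.1.le, one_div_mul_cancel hα.ne',
          Real.rpow_one, ENNReal.ofReal_mul (topEigenvalue_pos hα).le]
        ring
    _ = _ := lintegral_const_mul _ (hg.mul
        (ENNReal.measurable_ofReal.comp (continuous_eigenfun hc).measurable))

/-- Cauchy-Schwarz with a positive weight. -/
theorem sq_lintegral_le {X : Type*} [MeasurableSpace X] {μ : Measure X} {a p : X → ENNReal}
    (ha : Measurable a) (hp : Measurable p) (h : ∀ᵐ y ∂μ, p y ≠ 0 ∧ p y ≠ ⊤) :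
    (∫⁻ y, a y ∂μ) ^ 2 ≤ (∫⁻ y, p y ∂μ) * ∫⁻ y, a y ^ 2 / p y ∂μ := by
  have h1 : ∫⁻ y, a y ∂μ = ∫⁻ y, ((fun y => p y ^ (1 / 2 : ℝ)) *
      fun y => a y / p y ^ (1 / 2 : ℝ)) y ∂μ := by
    refine lintegral_congr_ae (h.mono fun y hy => ?_)
    simp only [Pi.mul_apply]
    rw [ENNReal.mul_div_cancel]
    · simp [ENNReal.rpow_eq_zero_iff, hy.1]
    · exact ENNReal.rpow_ne_top_of_nonneg (by norm_num) hy.2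
  have h2 := ENNReal.lintegral_mul_le_Lp_mul_Lq μ (p := 2) (q := 2)
    (f := fun y => p y ^ (1 / 2 : ℝ)) (g := fun y => a y / p y ^ (1 / 2 : ℝ))
    ⟨by norm_num, by norm_num, by norm_num⟩
    (hp.pow_const (1 / 2 : ℝ)).aemeasurable (ha.div (hp.pow_const (1 / 2 : ℝ))).aemeasurable
  rw [← h1] at h2
  have hsq : ∀ x : ENNReal, (x ^ (1 / 2 : ℝ)) ^ (2 : ℝ) = x := fun x => by
    rw [← ENNReal.rpow_mul]; norm_num
  have hsq' : ∀ x : ENNReal, (x ^ (1 / 2 : ℝ)) ^ 2 = x := fun x => by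
    rw [← ENNReal.rpow_natCast, ← ENNReal.rpow_mul]; norm_num
  calc (∫⁻ y, a y ∂μ) ^ 2 ≤ _ := pow_le_pow_left' h2 2
    _ = _ := by
      rw [mul_pow, hsq', hsq']
      congr 1
      · simp only [hsq]
      · simp only [ENNReal.div_rpow_of_nonneg _ _ (by norm_num : (0 : ℝ) ≤ 2), hsq,
          ENNReal.rpow_two]

variable {𝕜 : Type*} [RCLike 𝕜]

theorem ofReal_norm_sq_eq_lintegral (f : L2 𝕜) :
    ENNReal.ofReal (‖f‖ ^ 2) = ∫⁻ x in Ioc 0 1, ‖f x‖ₑ ^ 2 := by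
  have e : mu01 = volume.restrict (Ioc 0 1) := (Measure.restrict_congr_set Ioc_ae_eq_Icc).symm
  rw [ENNReal.ofReal_pow (norm_nonneg _), Lp.norm_def, ENNReal.ofReal_toReal (Lp.eLpNorm_ne_top f),
    eLpNorm_eq_lintegral_rpow_enorm_toReal (by norm_num) (by norm_num), ← ENNReal.rpow_natCast,
    ← ENNReal.rpow_mul]
  simp [e]

theorem ae_Ioc_of_ae_mu01 {p : ℝ → Prop} (h : ∀ᵐ x ∂mu01, p x) :
    ∀ᵐ x ∂volume.restrict (Ioc (0 : ℝ) 1), p x := by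
  rwa [Measure.restrict_congr_set Ioc_ae_eq_Icc]

theorem norm_T_sq_le {α : ℝ} (hα : 0 < α) (f : L2 𝕜) :
    ‖T 𝕜 α f‖ ^ 2 ≤ topEigenvalue α * ‖f‖ ^ 2 := by
  have hc := one_sub_inv_pos hα
  have hc1 := (one_sub_inv_lt hα).le
  have hfm : Measurable f := (Lp.stronglyMeasurable f).measurable
  have hpm : Measurable fun y => ENNReal.ofReal (eigenfun (1 - 1 / (1 + α)) y) :=
    ENNReal.measurable_ofReal.comp (continuous_eigenfun hc).measurable
  -- The eigenfunction vanishes at `1`, so this point has to be discarded.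
  have hlt : ∀ᵐ y ∂volume, y ≠ (1 : ℝ) := Measure.ae_ne volume 1
  have hpos : ∀ t ≤ (1 : ℝ), ∀ᵐ y ∂volume.restrict (Ioc 0 t),
      ENNReal.ofReal (eigenfun (1 - 1 / (1 + α)) y) ≠ 0 ∧
      ENNReal.ofReal (eigenfun (1 - 1 / (1 + α)) y) ≠ ⊤ := by
    intro t ht
    filter_upwards [ae_restrict_mem measurableSet_Ioc, ae_restrict_of_ae hlt] with y hy hy1
    refine ⟨?_, ENNReal.ofReal_ne_top⟩
    rw [Ne, ENNReal.ofReal_eq_zero, not_le]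
    exact eigenfun_pos hc hc1 ⟨hy.1.le, lt_of_le_of_ne (hy.2.trans ht) hy1⟩
  rw [← ENNReal.ofReal_le_ofReal_iff (by have := topEigenvalue_pos hα; positivity),
    ENNReal.ofReal_mul (topEigenvalue_pos hα).le, ofReal_norm_sq_eq_lintegral,
    ofReal_norm_sq_eq_lintegral]
  calc ∫⁻ x in Ioc 0 1, ‖T 𝕜 α f x‖ₑ ^ 2
      ≤ ∫⁻ x in Ioc 0 1, ENNReal.ofReal (eigenPrim (1 - 1 / (1 + α)) (x ^ α)) *
          ∫⁻ y in Ioc 0 (x ^ α), ‖f y‖ₑ ^ 2 / ENNReal.ofReal (eigenfun (1 - 1 / (1 + α)) y) := by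
        refine lintegral_mono_ae ?_
        filter_upwards [ae_Ioc_of_ae_mu01 (T_apply_ae hα.le f),
          ae_restrict_mem measurableSet_Ioc] with x hx hx01
        have hx' := rpow_mem_Icc hα.le ⟨hx01.1.le, hx01.2⟩
        rw [hx, intervalIntegral.integral_of_le hx'.1, ← lintegral_eigenfun hc hc1 hx']
        refine (pow_le_pow_left' (enorm_integral_le_lintegral_enorm _) 2).trans ?_
        exact sq_lintegral_le hfm.enorm hpm (hpos _ hx'.2)
    _ = _ := lintegral_eigenPrim_mul_lintegral hα ((hfm.enorm.pow_const 2).div hpm)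
    _ = _ := by
        congr 1
        refine lintegral_congr_ae ((hpos 1 le_rfl).mono fun y hy => ?_)
        exact ENNReal.div_mul_cancel hy.1 hy.2

theorem memLp_eigenfun (hc : 0 < c) : MemLp (fun y => (eigenfun c y : 𝕜)) 2 mu01 := by
  have hcont : Continuous fun y => (eigenfun c y : 𝕜) :=
    RCLike.continuous_ofReal.comp (continuous_eigenfun hc)
  obtain ⟨C, hC⟩ := (isCompact_Icc (a := (0 : ℝ)) (b := 1)).exists_bound_of_continuousOn
    hcont.continuousOn
  refine MemLp.of_bound hcont.aestronglyMeasurable C ?_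
  filter_upwards [ae_restrict_mem measurableSet_Icc] with y hy using hC y hy

/-- The eigenfunction as an element of `L²[0,1]`. -/
def eigenvec (𝕜 : Type*) [RCLike 𝕜] (hc : 0 < c) : L2 𝕜 := (memLp_eigenfun hc).toLp _

theorem coeFn_eigenvec (hc : 0 < c) : ∀ᵐ y ∂mu01, eigenvec 𝕜 hc y = (eigenfun c y : 𝕜) :=
  MemLp.coeFn_toLp _

theorem norm_eigenvec_pos (hc : 0 < c) (hc1 : c ≤ 1) : 0 < ‖eigenvec 𝕜 hc‖ := by
  rw [norm_pos_iff]
  intro h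
  have h1 : ∀ᵐ y ∂volume.restrict (Ioc (0 : ℝ) 1), False := by
    have h2 : ∀ᵐ y ∂mu01, eigenvec 𝕜 hc y = 0 := by
      rw [h]; exact Lp.coeFn_zero _ _ _
    filter_upwards [ae_Ioc_of_ae_mu01 h2, ae_Ioc_of_ae_mu01 (coeFn_eigenvec (𝕜 := 𝕜) hc),
      ae_restrict_mem measurableSet_Ioc, ae_restrict_of_ae (Measure.ae_ne volume (1 : ℝ))]
      with y hy hy1 hy2 hy3
    rw [hy1] at hy
    exact (eigenfun_pos hc hc1 ⟨hy2.1.le, lt_of_le_of_ne hy2.2 hy3⟩).ne' (by exact_mod_cast hy)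
  rw [eventually_false_iff_eq_bot, ae_eq_bot, Measure.restrict_eq_zero] at h1
  simp at h1

theorem norm_T_eigenvec_sq {α : ℝ} (hα : 0 < α) :
    ‖T 𝕜 α (eigenvec 𝕜 (one_sub_inv_pos hα))‖ ^ 2
      = topEigenvalue α * ‖eigenvec 𝕜 (one_sub_inv_pos hα)‖ ^ 2 := by
  have hc := one_sub_inv_pos hα
  have hc1 := (one_sub_inv_lt hα).le
  have hpm : Measurable fun y => ENNReal.ofReal (eigenfun (1 - 1 / (1 + α)) y) :=
    ENNReal.measurable_ofReal.comp (continuous_eigenfun hc).measurable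
  have hcoe := coeFn_eigenvec (𝕜 := 𝕜) hc
  have hen : ∀ {r : ℝ}, 0 ≤ r → ‖(r : 𝕜)‖ₑ = ENNReal.ofReal r := by
    intro r hr
    rw [← ofReal_norm, RCLike.norm_ofReal, abs_of_nonneg hr]
  have hpos := topEigenvalue_pos hα
  refine (ENNReal.ofReal_eq_ofReal_iff (by positivity) (by positivity)).1 ?_
  rw [ENNReal.ofReal_mul hpos.le, ofReal_norm_sq_eq_lintegral, ofReal_norm_sq_eq_lintegral]
  calc ∫⁻ x in Ioc 0 1, ‖T 𝕜 α (eigenvec 𝕜 hc) x‖ₑ ^ 2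
      = ∫⁻ x in Ioc 0 1, ENNReal.ofReal (eigenPrim (1 - 1 / (1 + α)) (x ^ α)) *
          ∫⁻ y in Ioc 0 (x ^ α), ENNReal.ofReal (eigenfun (1 - 1 / (1 + α)) y) := by
        refine lintegral_congr_ae ?_
        filter_upwards [ae_Ioc_of_ae_mu01 (T_apply_ae hα.le (eigenvec 𝕜 hc)),
          ae_restrict_mem measurableSet_Ioc] with x hx hx01
        have hx' := rpow_mem_Icc hα.le ⟨hx01.1.le, hx01.2⟩
        have e : ∫ y in (0 : ℝ)..(x ^ α), eigenvec 𝕜 hc y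
            = (eigenPrim (1 - 1 / (1 + α)) (x ^ α) : 𝕜) := by
          rw [← integral_eigenfun hc hx'.1, ← RCLike.intervalIntegral_ofReal]
          refine intervalIntegral.integral_congr_ae ?_
          have := (ae_restrict_iff' measurableSet_Ioc).1 (ae_Ioc_of_ae_mu01 hcoe)
          filter_upwards [this] with y hy hy2
          rw [uIoc_of_le hx'.1] at hy2
          exact hy ⟨hy2.1, hy2.2.trans hx'.2⟩
        rw [hx, e, hen (eigenPrim_nonneg hc hc1 hx'), lintegral_eigenfun hc hc1 hx', sq]
    _ = _ := lintegral_eigenPrim_mul_lintegral hα hpm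
    _ = _ := by
        congr 1
        refine lintegral_congr_ae ?_
        filter_upwards [ae_Ioc_of_ae_mu01 hcoe, ae_restrict_mem measurableSet_Ioc] with y hy hy01
        rw [hy, hen (eigenfun_nonneg hc hc1 ⟨hy01.1.le, hy01.2⟩), sq]

theorem norm_T_sq {α : ℝ} (hα : 0 < α) : ‖T 𝕜 α‖ ^ 2 = topEigenvalue α := by
  have hpos := topEigenvalue_pos hα
  apply le_antisymm
  · have : ‖T 𝕜 α‖ ≤ √(topEigenvalue α) := by
      refine ContinuousLinearMap.opNorm_le_bound _ (Real.sqrt_nonneg _) fun f => ?_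
      refine (pow_le_pow_iff_left₀ (norm_nonneg _) (by positivity) two_ne_zero).1 ?_
      rw [mul_pow, Real.sq_sqrt hpos.le]
      exact norm_T_sq_le hα f
    calc ‖T 𝕜 α‖ ^ 2 ≤ √(topEigenvalue α) ^ 2 := by gcongr
      _ = _ := Real.sq_sqrt hpos.le
  · have hv := norm_eigenvec_pos (𝕜 := 𝕜) (one_sub_inv_pos hα) (one_sub_inv_lt hα).le
    have h1 := norm_T_eigenvec_sq (𝕜 := 𝕜) hα
    have h2 := pow_le_pow_left₀ (norm_nonneg _)
      ((T 𝕜 α).le_opNorm (eigenvec 𝕜 (one_sub_inv_pos hα))) 2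
    rw [h1, mul_pow] at h2
    exact le_of_mul_le_mul_right h2 (by positivity)

theorem norm_T {α : ℝ} (hα : 0 < α) : ‖T 𝕜 α‖ = 1 / (1 + α) * √(α / h0 α) := by
  have hh := h0_pos hα
  refine (pow_left_inj₀ (norm_nonneg _) (by positivity) two_ne_zero).1 ?_
  rw [norm_T_sq hα, mul_pow, Real.sq_sqrt (by positivity), topEigenvalue]
  field_simp

/-! ### The adjoint of `T_{1/α}` -/

theorem T_zero_sub_T_apply_ae {α : ℝ} (hα : 0 < α) (f : L2 𝕜) :
    ∀ᵐ x ∂mu01, (T 𝕜 0 - T 𝕜 α) f x = ∫ y, (Ici (x ^ α)).indicator f y ∂mu01 := by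
  have hf : IntegrableOn f (Ioc 0 1) :=
    IntegrableOn.mono_set (t := Icc 0 1) (integrable_L2 f) Ioc_subset_Icc_self
  filter_upwards [T_apply_ae le_rfl f, T_apply_ae hα.le f, Lp.coeFn_sub (T 𝕜 0 f) (T 𝕜 α f),
    ae_restrict_mem measurableSet_Icc] with x h0 h1 h2 hx
  have hx' := rpow_mem_Icc hα.le hx
  rw [sub_apply, h2, Pi.sub_apply, h0, h1, Real.rpow_zero,
    intervalIntegral.integral_interval_sub_left
      ((intervalIntegrable_iff_integrableOn_Ioc_of_le zero_le_one).2 hf)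
      ((intervalIntegrable_iff_integrableOn_Ioc_of_le hx'.1).2
        (hf.mono_set (Ioc_subset_Ioc_right hx'.2))),
    intervalIntegral.integral_of_le hx'.2, integral_indicator measurableSet_Ici,
    Measure.restrict_restrict measurableSet_Ici, Measure.restrict_congr_set Ioc_ae_eq_Icc]
  congr 2
  ext y
  simp only [mem_Icc, mem_inter_iff, mem_Ici]
  exact ⟨fun h => ⟨h.1, hx'.1.trans h.1, h.2⟩, fun h => ⟨h.1, h.2.2⟩⟩

theorem T_apply_ae_indicator {α : ℝ} (hα : 0 ≤ α) (f : L2 𝕜) :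
    ∀ᵐ x ∂mu01, T 𝕜 α f x = ∫ y, (Iic (x ^ α)).indicator f y ∂mu01 := by
  filter_upwards [T_apply_ae hα f, ae_restrict_mem measurableSet_Icc] with x h hx
  have hx' := rpow_mem_Icc hα hx
  rw [h, intervalIntegral.integral_of_le hx'.1, integral_indicator measurableSet_Iic,
    Measure.restrict_restrict measurableSet_Iic, Measure.restrict_congr_set Ioc_ae_eq_Icc]
  congr 2
  ext y
  simp only [mem_Icc, mem_inter_iff, mem_Iic]
  exact ⟨fun h => ⟨h.2, h.1, h.2.trans hx'.2⟩, fun h => ⟨h.2.1, h.1⟩⟩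

/-- `T_0 - T_α` and `T_{1/α}` are adjoint to each other: both kernels are the indicator function of
the region `x^α ≤ y`. -/
theorem T_zero_sub_T_eq_adjoint {α : ℝ} (hα : 0 < α) :
    T 𝕜 0 - T 𝕜 α = ContinuousLinearMap.adjoint (T 𝕜 (1 / α)) := by
  rw [ContinuousLinearMap.eq_adjoint_iff]
  intro f g
  have hα' : 0 ≤ 1 / α := by positivity
  set S : Set (ℝ × ℝ) := {p | p.1 ^ α ≤ p.2} with hS
  have hSm : MeasurableSet S :=
    measurableSet_le (measurable_fst.pow_const α) measurable_snd
  set K : ℝ → ℝ → 𝕜 := fun x y =>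
    S.indicator (fun p : ℝ × ℝ => g p.1 * (starRingEnd 𝕜) (f p.2)) (x, y) with hK
  have hKi : Integrable (Function.uncurry K) (mu01.prod mu01) := by
    have h1 : Integrable (fun y => (starRingEnd 𝕜) (f y)) mu01 :=
      (RCLike.conjCLE (K := 𝕜)).toContinuousLinearMap.integrable_comp (integrable_L2 f)
    exact ((integrable_L2 g).mul_prod h1).indicator hSm
  rw [L2.inner_def, L2.inner_def]
  calc ∫ x, inner 𝕜 ((T 𝕜 0 - T 𝕜 α) f x) (g x) ∂mu01
      = ∫ x, ∫ y, K x y ∂mu01 ∂mu01 := by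
        refine integral_congr_ae ?_
        filter_upwards [T_zero_sub_T_apply_ae hα f] with x hx
        rw [hx, RCLike.inner_apply, ← integral_conj, ← integral_const_mul]
        refine integral_congr_ae (Eventually.of_forall fun y => ?_)
        by_cases h : x ^ α ≤ y <;> simp [hK, hS, indicator, h]
    _ = ∫ y, ∫ x, K x y ∂mu01 ∂mu01 := integral_integral_swap hKi
    _ = ∫ y, inner 𝕜 (f y) (T 𝕜 (1 / α) g y) ∂mu01 := by
        refine integral_congr_ae ?_
        filter_upwards [T_apply_ae_indicator hα' g, ae_restrict_mem measurableSet_Icc] with y hy hy01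
        rw [hy, RCLike.inner_apply, ← integral_mul_const]
        refine integral_congr_ae ?_
        filter_upwards [ae_restrict_mem measurableSet_Icc] with x hx
        have : x ^ α ≤ y ↔ x ≤ y ^ (1 / α) := by
          rw [one_div, Real.le_rpow_inv_iff_of_pos hx.1 hy01.1 hα]
        by_cases h : x ≤ y ^ (1 / α) <;> simp only [hK, hS, indicator, mem_ofPred_eq, this, h,
          mem_Iic, if_true, if_false, zero_mul]

theorem norm_T_sub_T_zero {α : ℝ} (hα : 0 < α) : ‖T 𝕜 α - T 𝕜 0‖ = ‖T 𝕜 (1 / α)‖ := by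
  rw [norm_sub_rev, T_zero_sub_T_eq_adjoint hα, LinearIsometryEquiv.norm_map]

/-! ### Asymptotics -/

theorem continuousAt_F_param (z : ℝ) : ContinuousAt (fun c => F c z) 1 := by
  have h : ContinuousOn (fun c => F c z) (Ici (1 / 2)) := by
    refine continuousOn_tsum (u := fun k : ℕ => (2 * |z|) ^ k / k.factorial) (fun k => ?_)
      (Real.summable_pow_div_factorial _) (fun k c hc => ?_)
    · refine ContinuousOn.mul (ContinuousOn.div continuousOn_const (by fun_prop) ?_)
        continuousOn_const
      intro c hc
      have hc0 : 0 < c := lt_of_lt_of_le (by norm_num) hc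
      have : 0 < ∏ j ∈ Finset.range k, (c + (j : ℝ)) := Finset.prod_pos fun j _ => by positivity
      positivity
    · have hc0 : 0 < c := lt_of_lt_of_le (by norm_num) hc
      rw [norm_mul, norm_pow, norm_neg, Real.norm_eq_abs, Real.norm_eq_abs,
        abs_of_pos (coef_pos hc0 k)]
      calc coef c k * |z| ^ k ≤ (1 / (1 / 2)) ^ k / k.factorial * |z| ^ k := by
            gcongr; exact coef_le (by norm_num) hc k
        _ = _ := by rw [mul_pow]; norm_num; ring
  exact h.continuousAt (Ici_mem_nhds (by norm_num))

theorem tendsto_firstZero : Tendsto firstZero (𝓝[<] 1) (𝓝 (firstZero 1)) := by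
  have hz0 := firstZero_pos one_pos le_rfl
  have hz2 : firstZero 1 < 2 := by have := firstZero_lt one_pos le_rfl; linarith
  have hev : ∀ b < (2 : ℝ), ∀ᶠ c in 𝓝[<] (1 : ℝ), 0 < c ∧ c ≤ 1 ∧ b ≤ 1 + c := by
    intro b hb
    filter_upwards [self_mem_nhdsWithin, nhdsWithin_le_nhds (lt_mem_nhds one_pos),
      nhdsWithin_le_nhds (lt_mem_nhds (show b - 1 < 1 by linarith))] with c h1 h2 h3
    exact ⟨h2, le_of_lt h1, by linarith⟩
  refine tendsto_order.2 ⟨fun a ha => ?_, fun a ha => ?_⟩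
  · have hb : max a 0 < firstZero 1 := max_lt ha hz0
    have hF : 0 < F 1 (max a 0) :=
      (F_pos_iff one_pos le_rfl (le_max_right _ _) (by linarith)).2 hb
    filter_upwards [hev _ (hb.trans hz2),
      nhdsWithin_le_nhds ((continuousAt_F_param (max a 0)).eventually (lt_mem_nhds hF))]
      with c hc hFc
    exact (le_max_left a 0).trans_lt ((F_pos_iff hc.1 hc.2.1 (le_max_right _ _) hc.2.2).1 hFc)
  · obtain ⟨b, hb1, hb2⟩ := exists_between (lt_min ha hz2)
    have hb0 : 0 ≤ b := (hz0.trans hb1).le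
    have hb2' := hb2.trans_le (min_le_right _ _)
    have hF : F 1 b < 0 := (F_neg_iff one_pos le_rfl hb0 (by linarith)).2 hb1
    filter_upwards [hev _ hb2',
      nhdsWithin_le_nhds ((continuousAt_F_param b).eventually (gt_mem_nhds hF))] with c hc hFc
    exact ((F_neg_iff hc.1 hc.2.1 hb0 hc.2.2).1 hFc).trans (hb2.trans_le (min_le_left _ _))

theorem tendsto_h0 : Tendsto h0 atTop (𝓝 h0Inf) := by
  have h1 : Tendsto (fun α : ℝ => 1 - 1 / (1 + α)) atTop (𝓝[<] 1) := by
    refine tendsto_nhdsWithin_iff.2 ⟨?_, ?_⟩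
    · have : Tendsto (fun α : ℝ => 1 / (1 + α)) atTop (𝓝 0) :=
        tendsto_const_nhds.div_atTop (tendsto_atTop_add_const_left _ _ tendsto_id)
      simpa using this.const_sub 1
    · filter_upwards [eventually_gt_atTop 0] with α hα using one_sub_inv_lt hα
  rw [h0Inf_eq_firstZero]
  exact (tendsto_firstZero.comp h1).congr fun α => (h0_eq_firstZero α).symm

theorem h0Inf_pos : 0 < h0Inf := by
  rw [h0Inf_eq_firstZero]; exact firstZero_pos one_pos le_rfl

theorem isEquivalent_norm_T_atTop :
    (fun α : ℝ => ‖T 𝕜 α‖) ~[atTop] (fun α : ℝ => (1 / √h0Inf) / √α) := by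
  have hh := h0Inf_pos
  refine IsEquivalent.symm ?_
  refine isEquivalent_of_tendsto_one ?_
  have h1 : Tendsto (fun α : ℝ => (1 / α + 1) * √(h0 α / h0Inf)) atTop (𝓝 1) := by
    have h2 := (Real.continuous_sqrt.tendsto _).comp (tendsto_h0.div_const h0Inf)
    have h3 : Tendsto (fun α : ℝ => 1 / α + 1) atTop (𝓝 (0 + 1)) :=
      (tendsto_const_nhds.div_atTop tendsto_id).add_const 1
    have h4 := h3.mul h2
    rw [div_self hh.ne', Real.sqrt_one, zero_add, mul_one] at h4
    exact h4
  refine h1.congr' ?_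
  filter_upwards [eventually_gt_atTop 0] with α hα
  have hp := h0_pos hα
  rw [Pi.div_apply, norm_T hα, Real.sqrt_div hα.le, Real.sqrt_div hp.le]
  have s1 := Real.sqrt_pos.2 hα
  have s2 := Real.sqrt_pos.2 hp
  have s3 := Real.sqrt_pos.2 hh
  have s4 := Real.sq_sqrt hα.le
  field_simp
  rw [s4]

theorem isEquivalent_norm_T_sub_T_zero :
    (fun α : ℝ => ‖T 𝕜 α - T 𝕜 0‖) ~[𝓝[>] 0] (fun α : ℝ => √(α / h0Inf)) := by
  have h := (isEquivalent_norm_T_atTop (𝕜 := 𝕜)).comp_tendsto tendsto_inv_nhdsGT_zero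
  refine (h.congr_left ?_).congr_right ?_
  · filter_upwards [self_mem_nhdsWithin] with α hα
    rw [norm_T_sub_T_zero hα, one_div, Function.comp]
  · filter_upwards [self_mem_nhdsWithin] with α hα
    rw [Function.comp, Real.sqrt_inv, Real.sqrt_div (le_of_lt hα)]
    field_simp

/-- The first zero of `F c` is `c (1 + c/2 + O(c²))` as `c → 0`. -/
theorem abs_firstZero_div_sub_le {c : ℝ} (hc : 0 < c) (hc1 : c ≤ 1 / 2) :
    |firstZero c / c - (1 + c / 2)| ≤ c ^ 2 := by
  have e1 : coef c 1 = 1 / c := by simp [coef]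
  have e2 : coef c 2 = 1 / (2 * (c * (1 + c))) := by
    simp [coef, Finset.prod_range_succ, Nat.factorial, add_comm]
  have e3 : coef c 3 = 1 / (6 * (c * (1 + c) * (2 + c))) := by
    simp [coef, Finset.prod_range_succ, Nat.factorial, add_comm]
  have hc2 : c ^ 2 ≤ c / 2 := by nlinarith
  have hcc : 0 < 1 + c := by linarith
  -- At both trial points the terms of order at most `c` cancel, and those of order `c²`
  -- decide the sign.
  have upper : firstZero c < c * (1 + c / 2 + c ^ 2) := by
    set w := 1 + c / 2 + c ^ 2 with hw
    have hw2 : w ≤ 2 := by linarith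
    have hw0 : 0 < w := by positivity
    have hz0 : 0 ≤ c * w := by positivity
    have hz1 : c * w ≤ 1 + c := by nlinarith
    refine (F_neg_iff hc (by linarith) hz0 hz1).1 ?_
    refine lt_of_le_of_lt (F_le_partial_sum hc hz0 hz1 1) ?_
    simp only [Finset.sum_range_succ, Finset.sum_range_zero, Nat.reduceMul, Nat.reduceAdd, e1, e2]
    have key : w ^ 2 < (1 + c) * (1 + 2 * c) := by rw [hw]; nlinarith [pow_pos hc 3, pow_pos hc 2]
    have e : 1 - (0 + (-1) ^ 0 * (1 / c * (c * w) ^ 1) +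
        (-1) ^ 1 * (1 / (2 * (c * (1 + c))) * (c * w) ^ 2))
        = c / (2 * (1 + c)) * (w ^ 2 - (1 + c) * (1 + 2 * c)) := by
      rw [hw]; field_simp; ring
    rw [e]
    exact mul_neg_of_pos_of_neg (by positivity) (by linarith)
  have lower : c * (1 + c / 2 - c ^ 2) < firstZero c := by
    set w := 1 + c / 2 - c ^ 2 with hw
    have hw1 : 1 ≤ w := by linarith
    have hw2 : w ≤ 5 / 4 := by nlinarith
    have hz0 : 0 ≤ c * w := by positivity
    have hz1 : c * w ≤ 1 + c := by nlinarith
    refine (F_pos_iff hc (by linarith) hz0 hz1).1 ?_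
    refine lt_of_lt_of_le ?_ (partial_sum_le_F hc hz0 hz1 1)
    simp only [Finset.sum_range_succ, Finset.sum_range_zero, Nat.reduceMul, Nat.reduceAdd, e1, e2,
      e3]
    have h3 : c ^ 2 * w ^ 3 / (6 * ((1 + c) * (2 + c))) ≤ c ^ 2 / 6 := by
      have : w ^ 3 ≤ (5 / 4) ^ 3 := by gcongr
      rw [div_le_div_iff₀ (by positivity) (by norm_num)]
      have h5 : w ^ 3 * 6 ≤ 6 * ((1 + c) * (2 + c)) := by nlinarith
      nlinarith [mul_le_mul_of_nonneg_left h5 (sq_nonneg c)]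
    have h2 : c / 2 - c ^ 3 ≤ c * w ^ 2 / (2 * (1 + c)) := by
      have : 1 + c - 2 * c ^ 2 ≤ w ^ 2 := by nlinarith [sq_nonneg (w - 1)]
      rw [le_div_iff₀ (by positivity)]
      nlinarith [mul_le_mul_of_nonneg_left this hc.le, pow_pos hc 4]
    have e : 1 - (0 + (-1) ^ 0 * (1 / c * (c * w) ^ 1) +
        (-1) ^ 1 * (1 / (2 * (c * (1 + c))) * (c * w) ^ 2) +
        (-1) ^ 2 * (1 / (6 * (c * (1 + c) * (2 + c))) * (c * w) ^ 3))
        = 1 - w + c * w ^ 2 / (2 * (1 + c)) - c ^ 2 * w ^ 3 / (6 * ((1 + c) * (2 + c))) := by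
      field_simp; ring
    rw [e]
    nlinarith [mul_le_mul_of_nonneg_left hc1 (sq_nonneg c), pow_pos hc 2]
  rw [abs_le]
  constructor
  · have := (lt_div_iff₀' hc).2 lower
    linarith
  · have := (div_lt_iff₀' hc).2 upper
    linarith

theorem norm_T_sub_isBigO :
    (fun α : ℝ => ‖T 𝕜 α‖ - (1 - 3 / 4 * α)) =O[𝓝[>] 0] (fun α : ℝ => α ^ 2) := by
  refine IsBigO.of_bound 20 ?_
  filter_upwards [Ioc_mem_nhdsGT (zero_lt_one (α := ℝ))] with α hα
  obtain ⟨hα, hα1⟩ := hα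
  have hc := one_sub_inv_pos hα
  set c := 1 - 1 / (1 + α) with hcdef
  have hcα : c * (1 + α) = α := by rw [hcdef]; field_simp; ring
  have hc1 : c ≤ 1 / 2 := by nlinarith
  have hca : c ≤ α := by nlinarith
  have hca2 : α - c ≤ α ^ 2 := by nlinarith
  set e := firstZero c / c - (1 + c / 2) with he
  have hb : |e| ≤ c ^ 2 := abs_firstZero_div_sub_le hc hc1
  have hfz : firstZero c = c * (1 + c / 2 + e) := by
    rw [he]; field_simp; ring
  obtain ⟨hb1, hb2⟩ := abs_le.1 hb
  have hw : 1 ≤ 1 + c / 2 + e := by nlinarith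
  have hN : ‖T 𝕜 α‖ ^ 2 * (1 + c / 2 + e) = 1 - c := by
    rw [norm_T_sq hα, topEigenvalue, h0_eq_firstZero, ← hcdef, hfz]
    have h1 : 1 - c = 1 / (1 + α) := by rw [hcdef]; ring
    have hw0 : 0 < 1 + c / 2 + e := by linarith
    rw [h1, div_mul_eq_mul_div, div_eq_div_iff (by positivity) (by positivity)]
    linear_combination -((1 + c / 2 + e) * (1 + α)) * hcα
  set N := ‖T 𝕜 α‖ with hNdef
  have hN0 : 0 ≤ N := norm_nonneg _
  have hc2 : c ^ 2 ≤ α ^ 2 := by gcongr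
  -- `‖T_α‖² = (1 - c) / (1 + c/2 + e)` is compared with `1 - 3c/2`, and `c` with `α`.
  have hd : (N ^ 2 - (1 - 3 / 2 * c)) * (1 + c / 2 + e) = 3 / 4 * c ^ 2 - e * (1 - 3 / 2 * c) := by
    linear_combination hN
  have hd1 : |N ^ 2 - (1 - 3 / 2 * c)| ≤ 2 * c ^ 2 := by
    have h1 : |N ^ 2 - (1 - 3 / 2 * c)| ≤ |N ^ 2 - (1 - 3 / 2 * c)| * (1 + c / 2 + e) :=
      le_mul_of_one_le_right (abs_nonneg _) hw
    have h2 : |N ^ 2 - (1 - 3 / 2 * c)| * (1 + c / 2 + e)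
        = |3 / 4 * c ^ 2 - e * (1 - 3 / 2 * c)| := by
      rw [← hd, abs_mul, abs_of_pos (by linarith : 0 < 1 + c / 2 + e)]
    refine h1.trans (h2.trans_le ?_)
    refine (abs_sub _ _).trans ?_
    rw [abs_of_nonneg (by positivity : 0 ≤ 3 / 4 * c ^ 2), abs_mul,
      abs_of_nonneg (by linarith : 0 ≤ 1 - 3 / 2 * c)]
    nlinarith [abs_nonneg e]
  obtain ⟨h1, h2⟩ := abs_le.1 hd1
  have hq : |N ^ 2 - (1 - 3 / 4 * α) ^ 2| ≤ 5 * α ^ 2 := by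
    rw [abs_le]
    constructor <;> nlinarith
  have hf : |N - (1 - 3 / 4 * α)| * (N + (1 - 3 / 4 * α)) = |N ^ 2 - (1 - 3 / 4 * α) ^ 2| := by
    rw [sq_sub_sq, abs_mul, abs_of_pos (by linarith : 0 < N + (1 - 3 / 4 * α)), mul_comm]
  rw [Real.norm_eq_abs, Real.norm_eq_abs, abs_of_nonneg (by positivity : 0 ≤ α ^ 2)]
  have h4 : 1 / 4 ≤ N + (1 - 3 / 4 * α) := by linarith
  nlinarith [mul_le_mul_of_nonneg_left h4 (abs_nonneg (N - (1 - 3 / 4 * α)))]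

end VolterraType
end

open VolterraType in
theorem corollary1 {𝕜 : Type*} [RCLike 𝕜] :
    -- the exact value of the norm; `h0 α` really is the smallest positive zero of `H_α`
    (∀ α : ℝ, 0 < α →
      IsLeast (posZeros (H α)) (h0 α) ∧
      ‖T 𝕜 α‖ = 1 / (1 + α) * √(α / h0 α)) ∧
    -- `h0Inf` really is the smallest positive zero of `H_∞`, and equals 1.445796...
    (IsLeast (posZeros HInf) h0Inf ∧ 1.445796 ≤ h0Inf ∧ h0Inf < 1.445797) ∧
    -- asymptotics
    (fun α : ℝ => ‖T 𝕜 α‖) ~[atTop] (fun α : ℝ => (1 / √h0Inf) / √α) ∧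
    (fun α : ℝ => ‖T 𝕜 α - T 𝕜 0‖) ~[𝓝[>] 0] (fun α : ℝ => √(α / h0Inf)) ∧
    (fun α : ℝ => ‖T 𝕜 α‖ - (1 - 3 / 4 * α)) =O[𝓝[>] 0] (fun α : ℝ => α ^ 2) := by
  refine ⟨fun α hα => ⟨?_, norm_T hα⟩, ⟨?_, ?_⟩, isEquivalent_norm_T_atTop,
    isEquivalent_norm_T_sub_T_zero, norm_T_sub_isBigO⟩
  · rw [h0_eq_firstZero, H_eq_F]
    exact isLeast_firstZero (one_sub_inv_pos hα) (one_sub_inv_lt hα).le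
  · rw [h0Inf_eq_firstZero, HInf_eq_F]
    exact isLeast_firstZero one_pos le_rfl
  · rw [h0Inf_eq_firstZero]
    exact firstZero_one_mem
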